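/- Let $N$ agents $\mathcal N=\{1,\dots,N\}$ have closed convex nonempty sets $\mathcal X_i\subseteq\mathbb R^{n_i}$, matrices $A_i\in\mathbb R^{l\times n_i}$ and jointly closed convex proper functions $J_i:\mathcal X_i\times\mathbb R^l\to\mathbb R\cup\{+\infty\}$, and let $c\in\mathbb R^l$. Put $s_i(x_{-i})=\sum_{j\ne i}A_jx_j$ and consider $$\text{minimize } J(x)=\sum_{i}J_i(x_i,s_i(x_{-i}))\quad\text{over } \tilde{\mathcal X}=\Big\{x\in\prod_i\mathcal X_i : \sum_iA_ix_i\le c\Big\};\tag{1}$$ a minimizer is a point $x\in\tilde{\mathcal X}$ with $J(x)<+\infty$ and $J(x)\le J(x')$ for all $x'\in\tilde{\mathcal X}$. Assume Slater's condition: some $x\in\prod_i\mathcal X_i$ satisfies $\sum_iA_ix_i<c$ componentwise. Let $\mathcal G=(\mathcal N,\mathcal E)$ be an undirected connected graph without self-loops in which every node has a neighbour; $\mathcal E$ is its set of directed edges, so $(i,j)\in\mathcal E$ if and only if $(j,i)\in\mathcal E$. Let $W\in\mathbb R^{N\times N}$ satisfy $W_{ij}<0$ if $(i,j)\in\mathcal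 E$, $W_{ij}=0$ if $j\ne i$ and $(i,j)\notin\mathcal E$, and $W_{ii}=-\sum_{j\neq i}W_{ij}$. The variables are $\psi=[x;\sigma;\lambda;\omega]$ with $\sigma=(\sigma_i)_{i\in\mathcal N}$, $\lambda=(\lambda_{ji})_{(j,i)\in\mathcal E}$ and $\omega$ consisting of $(y_i)_{i\in\mathcal N}$, $(\mu_{ji})_{(j,i)\in\mathcal E}$ and $(y_{ji})_{(j,i)\in\mathcal E}$, where all of $\sigma_i,\lambda_{ji},y_i,\mu_{ji},y_{ji}$ are in $\mathbb R^l$. Let $\mathcal Q_i=\{A_ix_i+\sigma_i\le c\}$, $\mathcal F_i=\{(N-1)A_ix_i-\sigma_i=W_{ii}y_i+\sum_{j:(j,i)\in\mathcal E}W_{ji}y_{ji}\}$, with $\iota$ denoting the $0/{+\infty}$ indicator function, and let $$\mathcal L_{\rm net}=\underbrace{\sum_i\big(J_i(x_i,\sigma_i)+\iota_{\mathcal X_i}+\iota_{\mathcal Q_i}+\iota_{\mathcal F_i}\big)}_{\Theta(\psi)}+\underbrace{\sum_{(j,i)\in\mathcal E}\big(\lambda_{ji}^T(A_ix_i+\sigma_i-A_jx_j-\sigma_j)+\mu_{ji}^T(y_{ji}-y_j)\big)}_{K(\psi)}.$$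 Let $T(\psi)=\partial\Theta(\psi)+D\psi$, where $\partial\Theta$ is the convex subdifferential (empty where $\Theta=+\infty$) and $D\psi$ is the gradient of $K$ with the sign of the components belonging to the dual variables $\lambda,\mu$ reversed. Then for every $[x^*;\sigma^*;\lambda^*;\omega^*]$ with $0\in T([x^*;\sigma^*;\lambda^*;\omega^*])$, the point $x^*$ is a minimizer of (1). Conversely, suppose in addition that there is $\hat x\in\tilde{\mathcal X}$ such that $(\hat x_i,s_i(\hat x_{-i}))$ lies in the relative interior of $\operatorname{dom}J_i=\{(x_i,s_i)\in\mathcal X_i\times\mathbb R^l: J_i(x_i,s_i)<+\infty\}$ for every $i$ (Slater's condition already implies this if all $J_i$ are finite on $\mathcal X_i\times\mathbb R^l$). Then for every minimizer $x^\dagger$ of (1) there are $\sigma^\dagger,\lambda^\dagger,\omega^\dagger$ with $0\in T([x^\dagger;\sigma^\dagger;\lambda^\dagger;\omega^\dagger])$. -/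

import Mathlib

open scoped Matrix

noncomputable section

/-- Effective domain, within `S`, of a function with values in `ℝ ∪ {+∞}`. -/
def effDomOn {V : Type*} (S : Set V) (f : V → WithTop ℝ) : Set V :=
  {p | p ∈ S ∧ f p < ⊤}

/-- Epigraph of the restriction of `f` to `S`. -/
def epigraphOn {V : Type*} (S : Set V) (f : V → WithTop ℝ) : Set (V × ℝ) :=
  {q | q.1 ∈ S ∧ f q.1 ≤ (q.2 : WithTop ℝ)}

/-- `f : S → ℝ ∪ {+∞}` is closed, convex and proper. Values of `f` outside `S` are irrelevant. -/
structure IsCCPOn {V : Type*} [AddCommGroup V] [Module ℝ V] [TopologicalSpace V]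
    (S : Set V) (f : V → WithTop ℝ) : Prop where
  closed : IsClosed (epigraphOn S f)
  convex : Convex ℝ (epigraphOn S f)
  proper : (effDomOn S f).Nonempty

open Classical in
/-- The indicator function of a set in the sense of convex analysis. -/
def convIndicator {V : Type*} (S : Set V) (p : V) : WithTop ℝ :=
  if p ∈ S then 0 else ⊤

/-- Data of the aggregatively coupled problem with `N` agents and `l` resources: dimensions `n i`,
objectives `J i (x_i, s_i)`, local sets `X i`, matrices `A i` and the resource vector `c`. -/
structure AggProblem (N l : ℕ) where
  n : Fin N → ℕ
  J : ∀ i, (Fin (n i) → ℝ) × (Fin l → ℝ) → WithTop ℝ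
  X : ∀ i, Set (Fin (n i) → ℝ)
  A : ∀ i, Matrix (Fin l) (Fin (n i)) ℝ
  c : Fin l → ℝ

namespace AggProblem

variable {N l : ℕ} (P : AggProblem N l)

/-- Joint decisions `x = [x_1; …; x_N]`. -/
abbrev Decision : Type := ∀ i, Fin (P.n i) → ℝ

/-- The domain `X_i × ℝ^l` of `J_i`. -/
def objDomain (i : Fin N) : Set ((Fin (P.n i) → ℝ) × (Fin l → ℝ)) :=
  P.X i ×ˢ Set.univ

/-- `s_i(x_{-i}) = ∑_{j ≠ i} A_j x_j`. -/
def aggregate (i : Fin N) (x : P.Decision) : Fin l → ℝ :=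
  ∑ j ∈ Finset.univ.erase i, P.A j *ᵥ x j

/-- `J(x) = ∑_i J_i(x_i, s_i(x_{-i}))`. -/
def objective (x : P.Decision) : WithTop ℝ :=
  ∑ i, P.J i (x i, P.aggregate i x)

/-- The globally constrained set `{x ∈ ∏ X_i | ∑_i A_i x_i ≤ c}`. -/
def feasible : Set P.Decision :=
  {x | (∀ i, x i ∈ P.X i) ∧ ∑ i, P.A i *ᵥ x i ≤ P.c}

/-- Slater's constraint qualification for the globally constrained set. -/
def Slater : Prop :=
  ∃ x : P.Decision, (∀ i, x i ∈ P.X i) ∧ ∀ k, (∑ i, P.A i *ᵥ x i) k < P.c k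

/-- Domain qualification: some feasible `x` has every `(x_i, s_i(x_{-i}))` in the relative interior
of the effective domain of `J_i`. -/
def DomainQualified : Prop :=
  ∃ x ∈ P.feasible, ∀ i,
    (x i, P.aggregate i x) ∈ intrinsicInterior ℝ (effDomOn (P.objDomain i) (P.J i))

/-- Minimizers of the original problem (with finite optimal value). -/
def IsMinimizer (x : P.Decision) : Prop :=
  x ∈ P.feasible ∧ P.objective x < ⊤ ∧ ∀ x' ∈ P.feasible, P.objective x ≤ P.objective x'

end AggProblem

/-- Weight matrices of a graph: `W_ij < 0` on edges, `W_ij = 0` for distinct non-adjacent `i, j`,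
and `W_ii = -∑_{j ≠ i} W_ij`. -/
structure IsWeightMatrix {N : ℕ} (G : SimpleGraph (Fin N)) (W : Matrix (Fin N) (Fin N) ℝ) :
    Prop where
  neg : ∀ i j, G.Adj i j → W i j < 0
  zero : ∀ i j, i ≠ j → ¬ G.Adj i j → W i j = 0
  diag : ∀ i, W i i = -∑ j ∈ Finset.univ.erase i, W i j

/-- Incidence matrix over the directed edges: `+1` at the head, `-1` at the tail. An undirected
edge gives two directed edges. -/
def incidence {N : ℕ} (G : SimpleGraph (Fin N)) : Matrix (Fin N) G.Dart ℝ :=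
  fun i e => (if e.snd = i then 1 else 0) - (if e.fst = i then 1 else 0)

namespace AggProblem

variable {N l : ℕ} (P : AggProblem N l) (G : SimpleGraph (Fin N))

/-- The variables `ω`: `y_i` for each agent, then, for each directed edge `(i, j)`, the
multiplier `μ_ij` and agent `j`'s estimate `y_ij` of `y_i`. -/
abbrev Omega (_P : AggProblem N l) (G : SimpleGraph (Fin N)) : Type :=
  (Fin N → Fin l → ℝ) × (G.Dart → Fin l → ℝ) × (G.Dart → Fin l → ℝ)

/-- The stacked variable `ψ = [x; σ; λ; ω]`. -/
abbrev Stack : Type :=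
  P.Decision × (Fin N → Fin l → ℝ) × (G.Dart → Fin l → ℝ) × P.Omega G

variable {P G}

/-- Block `x` of `ψ`. -/
abbrev Stack.x (ψ : P.Stack G) : P.Decision := ψ.1
/-- Block `σ` of `ψ`. -/
abbrev Stack.sig (ψ : P.Stack G) : Fin N → Fin l → ℝ := ψ.2.1
/-- Block `λ` of `ψ`. -/
abbrev Stack.lam (ψ : P.Stack G) : G.Dart → Fin l → ℝ := ψ.2.2.1
/-- Block `y` of `ω`. -/
abbrev Stack.y (ψ : P.Stack G) : Fin N → Fin l → ℝ := ψ.2.2.2.1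
/-- Block `μ` of `ω`. -/
abbrev Stack.mu (ψ : P.Stack G) : G.Dart → Fin l → ℝ := ψ.2.2.2.2.1
/-- Block of the local estimates `y_ij` of `ω`. -/
abbrev Stack.est (ψ : P.Stack G) : G.Dart → Fin l → ℝ := ψ.2.2.2.2.2

variable (P G) [DecidableRel G.Adj]

/-- Euclidean inner product of two stacked vectors. -/
def stackInner (u v : P.Stack G) : ℝ :=
  ∑ i, u.x i ⬝ᵥ v.x i + ∑ i, u.sig i ⬝ᵥ v.sig i + ∑ e, u.lam e ⬝ᵥ v.lam e
    + ∑ i, u.y i ⬝ᵥ v.y i + ∑ e, u.mu e ⬝ᵥ v.mu e + ∑ e, u.est e ⬝ᵥ v.est e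

/-- The convex subdifferential of `F` at `ψ`; it is empty outside the effective domain. -/
def subdifferential (F : P.Stack G → WithTop ℝ) (ψ : P.Stack G) : Set (P.Stack G) :=
  {u | F ψ < ⊤ ∧ ∀ ψ' : P.Stack G, F ψ + ((P.stackInner G u (ψ' - ψ) : ℝ) : WithTop ℝ) ≤ F ψ'}

/-- `Q_i`: the pairs with `A_i x_i + σ_i ≤ c`. -/
def setQ (i : Fin N) : Set ((Fin (P.n i) → ℝ) × (Fin l → ℝ)) :=
  {p | P.A i *ᵥ p.1 + p.2 ≤ P.c}

/-- `F_i`, seen as a condition on `ψ`: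
`(N-1) A_i x_i - σ_i = W_ii y_i + ∑_{(j,i) ∈ E} W_ji y_ji`. -/
def setF (W : Matrix (Fin N) (Fin N) ℝ) (i : Fin N) : Set (P.Stack G) :=
  {ψ | ((N : ℝ) - 1) • (P.A i *ᵥ ψ.x i) - ψ.sig i
      = W i i • ψ.y i + ∑ e : G.Dart with e.snd = i, W e.fst i • ψ.est e}

/-- `∑_i (J_i(x_i, σ_i) + ι_{X_i}(x_i) + ι_{Q_i}(x_i, σ_i) + ι_{F_i}(x_i, σ_i, y_i))`, the part of
the network Lagrangian without the multiplier terms. -/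
def primalPart (W : Matrix (Fin N) (Fin N) ℝ) (ψ : P.Stack G) : WithTop ℝ :=
  ∑ i, (P.J i (ψ.x i, ψ.sig i) + convIndicator (P.X i) (ψ.x i)
    + convIndicator (P.setQ i) (ψ.x i, ψ.sig i) + convIndicator (P.setF G W i) ψ)

/-- The skew-symmetric linear part of the operator: the partial gradients of
`∑_{(j,i) ∈ E} (λ_ji ⬝ (A_i x_i + σ_i - A_j x_j - σ_j) + μ_ji ⬝ (y_ji - y_j))`, with the sign of
the rows of the dual variables `λ`, `μ` reversed. -/
def skewPart (ψ : P.Stack G) : P.Stack G :=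
  (fun i => (P.A i)ᵀ *ᵥ ∑ e, incidence G i e • ψ.lam e,
   fun i => ∑ e, incidence G i e • ψ.lam e,
   fun e => -∑ i, incidence G i e • (P.A i *ᵥ ψ.x i) - ∑ i, incidence G i e • ψ.sig i,
   fun i => -∑ e : G.Dart with e.fst = i, ψ.mu e,
   fun e => ψ.y e.fst - ψ.est e,
   fun e => ψ.mu e)

/-- The set-valued operator `T`. -/
def opT (W : Matrix (Fin N) (Fin N) ℝ) (ψ : P.Stack G) : Set (P.Stack G) :=
  {w | ∃ u ∈ P.subdifferential G (P.primalPart G W) ψ, w = u + P.skewPart G ψ}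

/-- The zero set of `T`. -/
def zerT (W : Matrix (Fin N) (Fin N) ℝ) : Set (P.Stack G) :=
  {ψ | 0 ∈ P.opT G W ψ}

end AggProblem

end

/-!
A zero of `T` is a saddle point of the network Lagrangian over the domain of its primal part `Θ`.
Maximality in `λ` and `μ` forces all agents to agree on the load `A_i x_i + σ_i` and all estimates
`y_ji` to be exact. The sum of the equations `F_i`, in which `W` disappears because its rows sum to
zero, then identifies `σ_i` with `s_i(x_{-i})`, and the saddle inequality becomes minimality.

Conversely, a minimizer extends to a consistent state because `Wᵀ y = v` is solvable for every
`v` with entries summing to zero: by the maximum principle on the connected graph the kernel of `W`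
consists of the constant vectors. Multipliers for the affine consistency equations come from
a Farkas lemma that tolerates the inequalities `Q_i` not being strict at the reference point: an
inequality that vanishes on the whole feasible set is treated as an equation, and otherwise a
midpoint with a strictly feasible point is an interior one.
-/

noncomputable section

section IntrinsicCore

open Filter Topology AffineMap

variable {V W : Type*} [AddCommGroup V] [Module ℝ V] [AddCommGroup W] [Module ℝ W]
variable {C : Set V} {z : V}

/-- The intrinsic core (algebraic relative interior) of `C`: the points `z` of `C` beyond which
every segment `[w, z]` of `C` can be prolonged inside `C`. It replaces the topological relative
interior in the multiplier theorems, which then need no topology on the ambient space. -/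
def intrinsicCore (C : Set V) : Set V :=
  {z ∈ C | ∀ w ∈ C, ∀ᶠ t in 𝓝[>] (1 : ℝ), lineMap w z t ∈ C}

lemma mem_intrinsicCore_of_convex (hC : Convex ℝ C) (hz : z ∈ C)
    (h : ∀ w ∈ C, ∃ t : ℝ, 1 < t ∧ lineMap w z t ∈ C) : z ∈ intrinsicCore C := by
  refine ⟨hz, fun w hw => ?_⟩
  obtain ⟨t, ht, hmem⟩ := h w hw
  filter_upwards [Ioc_mem_nhdsGT ht] with s hs
  have hsegment := hC.lineMap_mem hz hmem (t := (s - 1) / (t - 1))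
    ⟨div_nonneg (by linarith [hs.1]) (by linarith),
      (div_le_one (by linarith)).2 (by linarith [hs.2])⟩
  convert hsegment using 1
  have : t - 1 ≠ 0 := by linarith
  simp only [lineMap_apply_module]
  match_scalars <;> field_simp <;> ring

lemma intrinsicInterior_subset_intrinsicCore [TopologicalSpace V] [IsTopologicalAddGroup V]
    [ContinuousSMul ℝ V] : intrinsicInterior ℝ C ⊆ intrinsicCore C := by
  intro z hz
  refine ⟨intrinsicInterior_subset hz, fun w hw => ?_⟩
  obtain ⟨y, hy, rfl⟩ := mem_intrinsicInterior.1 hz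
  let line : ℝ → affineSpan ℝ C := fun t =>
    ⟨lineMap w (y : V) t, lineMap_mem t (subset_affineSpan ℝ C hw) y.2⟩
  have hline : Continuous line := by
    refine Continuous.subtype_mk ?_ _
    exact lineMap_continuous
  have hone : line 1 = y := by ext; simp [line]
  have hnhds : (↑) ⁻¹' C ∈ 𝓝 (line 1) := by
    rw [hone]
    exact mem_interior_iff_mem_nhds.1 hy
  exact (hline.continuousAt.eventually_mem hnhds).filter_mono nhdsWithin_le_nhds

lemma preimage_intrinsicCore_subset (L : V →ᵃ[ℝ] W) (D : Set W) :
    L ⁻¹' intrinsicCore D ⊆ intrinsicCore (L ⁻¹' D) := by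
  refine fun z hz => ⟨hz.1, fun w hw => ?_⟩
  filter_upwards [hz.2 (L w) hw] with t ht
  rwa [Set.mem_preimage, apply_lineMap]

lemma pi_intrinsicCore_subset {ι : Type*} [Finite ι] {E : ι → Type*}
    [∀ i, AddCommGroup (E i)] [∀ i, Module ℝ (E i)] (D : ∀ i, Set (E i)) :
    Set.univ.pi (fun i => intrinsicCore (D i)) ⊆ intrinsicCore (Set.univ.pi D) := by
  refine fun z hz => ⟨fun i _ => (hz i trivial).1, fun w hw => ?_⟩
  filter_upwards [eventually_all.2 fun i => (hz i trivial).2 (w i) (hw i trivial)] with t ht i _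
  simpa only [pi_lineMap_apply] using ht i

lemma mem_intrinsicCore_inter_preimage_singleton (hz : z ∈ intrinsicCore C)
    (L : V →ᵃ[ℝ] W) : z ∈ intrinsicCore (C ∩ L ⁻¹' {L z}) := by
  refine ⟨⟨hz.1, rfl⟩, fun w hw => ?_⟩
  filter_upwards [hz.2 w hw.1] with t ht
  have hLw : L w = L z := hw.2
  exact ⟨ht, by rw [Set.mem_preimage, apply_lineMap, hLw, lineMap_same_apply]; rfl⟩

lemma mem_intrinsicCore_inter_nonpos (hz : z ∈ intrinsicCore C) {g : V →ᵃ[ℝ] ℝ} (hg : g z < 0) :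
    z ∈ intrinsicCore (C ∩ {w | g w ≤ 0}) := by
  refine ⟨⟨hz.1, hg.le⟩, fun w hw => ?_⟩
  have hcont : Continuous fun t : ℝ => g (lineMap w z t) := by
    simp only [apply_lineMap, lineMap_apply_ring]
    fun_prop
  have hneg : ∀ᶠ t in 𝓝[>] (1 : ℝ), g (lineMap w z t) < 0 :=
    (hcont.continuousAt.eventually_lt_const (by simpa using hg)).filter_mono nhdsWithin_le_nhds
  filter_upwards [hz.2 w hw.1, hneg] with t ht ht'
  exact ⟨ht, ht'.le⟩

lemma midpoint_mem_intrinsicCore (hC : Convex ℝ C) (hz : z ∈ intrinsicCore C) {v : V}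
    (hv : v ∈ C) : midpoint ℝ z v ∈ intrinsicCore C := by
  refine mem_intrinsicCore_of_convex hC (hC.midpoint_mem hz.1 hv) fun w hw => ?_
  obtain ⟨t, ht, h1t⟩ := ((hz.2 w hw).and self_mem_nhdsWithin).exists
  replace h1t : 1 < t := h1t
  have ht0 : 0 < 1 + t := by linarith
  refine ⟨2 * t / (1 + t), by rw [lt_div_iff₀ ht0]; linarith, ?_⟩
  have hsegment := hC.lineMap_mem ht hv (t := t / (1 + t))
    ⟨div_nonneg (by linarith) ht0.le, (div_le_one ht0).2 (by linarith)⟩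
  convert hsegment using 1
  simp only [midpoint_eq_smul_add, invOf_eq_inv, lineMap_apply_module]
  match_scalars <;> field_simp <;> ring

lemma eq_zero_of_forall_nonneg_of_mem_intrinsicCore {g : V →ᵃ[ℝ] ℝ} (hz : z ∈ intrinsicCore C)
    (hnonneg : ∀ w ∈ C, 0 ≤ g w) (hgz : g z ≤ 0) {w : V} (hw : w ∈ C) : g w = 0 := by
  obtain ⟨t, ht, h1t⟩ := ((hz.2 w hw).and self_mem_nhdsWithin).exists
  replace h1t : 1 < t := h1t
  have hline := hnonneg _ ht
  rw [apply_lineMap, lineMap_apply_ring, le_antisymm hgz (hnonneg z hz.1)] at hline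
  nlinarith [hnonneg w hw]

end IntrinsicCore

section Multipliers

variable {V : Type*} [AddCommGroup V] [Module ℝ V] {C : Set V} {f : V → ℝ} {g : V →ᵃ[ℝ] ℝ} {z : V}

lemma convexOn_affineMap (hC : Convex ℝ C) (g : V →ᵃ[ℝ] ℝ) : ConvexOn ℝ C g :=
  ((convexOn_id convex_univ).comp_affineMap g).subset (Set.subset_univ _) hC

lemma neg_div_le_div_neg_of_convexOn (hf : ConvexOn ℝ C f)
    (hnonneg : ∀ w ∈ C, g w = 0 → 0 ≤ f w) {p q : V} (hp : p ∈ C) (hgp : 0 < g p) (hq : q ∈ C)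
    (hgq : g q < 0) : -f p / g p ≤ f q / -g q := by
  have hd : 0 < g p - g q := by linarith
  set a := -g q / (g p - g q) with ha_def
  set b := g p / (g p - g q) with hb_def
  have ha : 0 ≤ a := div_nonneg (by linarith) hd.le
  have hb : 0 ≤ b := div_nonneg hgp.le hd.le
  have hab : a + b = 1 := by rw [ha_def, hb_def]; field_simp; ring
  have hzero : g (a • p + b • q) = 0 := by
    rw [Convex.combo_affine_apply hab, ha_def, hb_def, smul_eq_mul, smul_eq_mul]
    field_simp
    ring
  have hcombo : 0 ≤ a * f p + b * f q :=
    (hnonneg _ (hf.1 hp hq ha hb hab) hzero).trans (hf.2 hp hq ha hb hab)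
  have hscaled : 0 ≤ -g q * f p + g p * f q := by
    have := mul_nonneg hcombo hd.le
    rw [ha_def, hb_def] at this
    field_simp at this
    linarith
  rw [div_le_div_iff₀ hgp (by linarith)]
  linarith

lemma exists_forall_nonneg_add_mul_of_pos_of_neg (hf : ConvexOn ℝ C f)
    (hnonneg : ∀ w ∈ C, g w = 0 → 0 ≤ f w) (hpos : ∃ p ∈ C, 0 < g p) (hneg : ∃ q ∈ C, g q < 0) :
    ∃ β : ℝ, ∀ w ∈ C, 0 ≤ f w + β * g w := by
  obtain ⟨p, hp, hgp⟩ := hpos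
  obtain ⟨q, hq, hgq⟩ := hneg
  obtain ⟨β, hlower, hupper⟩ := exists_between_of_forall_le
    (s := (fun w => -f w / g w) '' {w ∈ C | 0 < g w})
    (t := (fun w => f w / -g w) '' {w ∈ C | g w < 0})
    ⟨_, p, ⟨hp, hgp⟩, rfl⟩ ⟨_, q, ⟨hq, hgq⟩, rfl⟩ (by
      rintro _ ⟨p, ⟨hp, hgp⟩, rfl⟩ _ ⟨q, ⟨hq, hgq⟩, rfl⟩
      exact neg_div_le_div_neg_of_convexOn hf hnonneg hp hgp hq hgq)
  refine ⟨β, fun w hw => ?_⟩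
  rcases lt_trichotomy (g w) 0 with h | h | h
  · have := hupper ⟨w, ⟨hw, h⟩, rfl⟩
    rw [le_div_iff₀ (by linarith)] at this
    linarith
  · simpa [h] using hnonneg w hw h
  · have := hlower ⟨w, ⟨hw, h⟩, rfl⟩
    rw [div_le_iff₀ h] at this
    linarith

lemma exists_forall_nonneg_add_mul_of_eq_zero (hf : ConvexOn ℝ C f) (hz : z ∈ intrinsicCore C)
    (hgz : g z = 0) (hnonneg : ∀ w ∈ C, g w = 0 → 0 ≤ f w) :
    ∃ β : ℝ, ∀ w ∈ C, 0 ≤ f w + β * g w := by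
  by_cases! hneg : ∀ w ∈ C, 0 ≤ g w
  · have hzero : ∀ w ∈ C, g w = 0 := fun w =>
      eq_zero_of_forall_nonneg_of_mem_intrinsicCore hz hneg hgz.le
    exact ⟨0, fun w hw => by simpa using hnonneg w hw (hzero w hw)⟩
  by_cases! hpos : ∀ w ∈ C, g w ≤ 0
  · have hzero : ∀ w ∈ C, -g w = 0 := fun w =>
      eq_zero_of_forall_nonneg_of_mem_intrinsicCore (g := -g) hz
        (fun w hw => neg_nonneg.2 (hpos w hw)) (neg_nonpos.2 hgz.ge)
    exact ⟨0, fun w hw => by simpa using hnonneg w hw (neg_eq_zero.1 (hzero w hw))⟩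
  exact exists_forall_nonneg_add_mul_of_pos_of_neg hf hnonneg hpos hneg

lemma exists_nonneg_forall_nonneg_add_mul_of_neg (hf : ConvexOn ℝ C f) (hz : z ∈ C)
    (hgz : g z < 0) (hnonneg : ∀ w ∈ C, g w ≤ 0 → 0 ≤ f w) :
    ∃ β : ℝ, 0 ≤ β ∧ ∀ w ∈ C, 0 ≤ f w + β * g w := by
  by_cases! hpos : ∀ w ∈ C, g w ≤ 0
  · exact ⟨0, le_rfl, fun w hw => by simpa using hnonneg w hw (hpos w hw)⟩
  obtain ⟨β, hβ⟩ := exists_forall_nonneg_add_mul_of_pos_of_neg hf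
    (fun w hw h => hnonneg w hw h.le) hpos ⟨z, hz, hgz⟩
  refine ⟨max β 0, le_max_right _ _, fun w hw => ?_⟩
  rcases le_or_gt (g w) 0 with h | h
  · rcases max_choice β 0 with e | e <;> rw [e]
    · exact hβ w hw
    · simpa using hnonneg w hw h
  · nlinarith [hβ w hw, le_max_left β 0]

lemma apply_nonpos_of_mem_hull {S : Set (V →ᵃ[ℝ] ℝ)} {φ : V →ᵃ[ℝ] ℝ}
    (hφ : φ ∈ PointedCone.hull ℝ S) {w : V} (hw : ∀ g ∈ S, g w ≤ 0) : φ w ≤ 0 := by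
  induction hφ using Submodule.span_induction with
  | mem g hg => exact hw g hg
  | zero => exact le_rfl
  | add φ ψ _ _ hφ hψ => exact add_nonpos hφ hψ
  | smul c φ _ hφ => exact mul_nonpos_of_nonneg_of_nonpos c.2 hφ

lemma exists_mem_hull_insert_forall_nonneg_add {S : Set (V →ᵃ[ℝ] ℝ)} {φ ν : V →ᵃ[ℝ] ℝ}
    (hφ : φ ∈ PointedCone.hull ℝ S) (hν : ν ∈ PointedCone.hull ℝ S)
    (hzero : ∀ w ∈ C, (g + φ) w = 0) {β : ℝ} (hβ : ∀ w ∈ C, 0 ≤ f w + ν w + β * g w) :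
    ∃ χ ∈ PointedCone.hull ℝ (insert g S), ∀ w ∈ C, 0 ≤ f w + χ w := by
  have hmono : PointedCone.hull ℝ S ≤ PointedCone.hull ℝ (insert g S) :=
    Submodule.span_mono (Set.subset_insert g S)
  have hg : g ∈ PointedCone.hull ℝ (insert g S) := Submodule.subset_span (Set.mem_insert g S)
  rcases le_total 0 β with hβ0 | hβ0
  · refine ⟨ν + β • g, add_mem (hmono hν) (PointedCone.smul_mem _ hβ0 hg), fun w hw => ?_⟩
    simpa [add_assoc] using hβ w hw
  -- On `C` we have `g = -φ`, so a negative multiple of `g` is a positive multiple of `φ`.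
  · refine ⟨ν + -β • φ, add_mem (hmono hν)
      (PointedCone.smul_mem _ (neg_nonneg.2 hβ0) (hmono hφ)), fun w hw => ?_⟩
    have hgφ : g w = -φ w := eq_neg_of_add_eq_zero_left (hzero w hw)
    simpa [hgφ, add_assoc] using hβ w hw

lemma affineMap_midpoint (g : V →ᵃ[ℝ] ℝ) (z v : V) : g (midpoint ℝ z v) = (g z + g v) / 2 := by
  rw [g.map_midpoint, midpoint_eq_smul_add, invOf_eq_inv, smul_eq_mul, inv_mul_eq_div]

lemma convex_inter_nonpos (hC : Convex ℝ C) (g : V →ᵃ[ℝ] ℝ) : Convex ℝ (C ∩ {w | g w ≤ 0}) :=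
  hC.inter ((convex_Iic 0).affine_preimage g)

/-- Farkas' lemma for the affine constraints `g ≤ 0`, `g ∈ S`, under the refined Slater
condition. -/
theorem exists_mem_hull_forall_nonneg_add {S : Set (V →ᵃ[ℝ] ℝ)} (hS : S.Finite)
    (hf : ConvexOn ℝ C f) (hz : z ∈ intrinsicCore C) (hSz : ∀ g ∈ S, g z ≤ 0)
    (hnonneg : ∀ w ∈ C, (∀ g ∈ S, g w ≤ 0) → 0 ≤ f w) :
    ∃ φ ∈ PointedCone.hull ℝ S, ∀ w ∈ C, 0 ≤ f w + φ w := by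
  induction S, hS using Set.Finite.induction_on generalizing C f z with
  | empty => exact ⟨0, zero_mem _, fun w hw => by simpa using hnonneg w hw (by simp)⟩
  | @insert g S _ _ ih =>
    rw [Set.forall_mem_insert] at hSz
    simp only [Set.forall_mem_insert, and_imp] at hnonneg
    by_cases! hstrict : ∃ v ∈ C, (∀ h ∈ S, h v ≤ 0) ∧ g v < 0
    · obtain ⟨v, hv, hSv, hgv⟩ := hstrict
      have hm := midpoint_mem_intrinsicCore hf.1 hz hv
      have hgm : g (midpoint ℝ z v) < 0 := by rw [affineMap_midpoint]; linarith
      obtain ⟨φ, hφ, hfφ⟩ := ih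
        (hf.subset Set.inter_subset_left (convex_inter_nonpos hf.1 g))
        (mem_intrinsicCore_inter_nonpos hm hgm)
        (fun h hh => by rw [affineMap_midpoint]; linarith [hSz.2 h hh, hSv h hh])
        (fun w hw => hnonneg w hw.1 hw.2)
      obtain ⟨β, hβ, hfφβ⟩ := exists_nonneg_forall_nonneg_add_mul_of_neg
        (hf.add (convexOn_affineMap hf.1 φ)) hm.1 hgm fun w hw hgw => hfφ w ⟨hw, hgw⟩
      refine ⟨φ + β • g, add_mem (Submodule.span_mono (Set.subset_insert g S) hφ)
        (PointedCone.smul_mem _ hβ (Submodule.subset_span (Set.mem_insert g S))), fun w hw => ?_⟩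
      simpa [add_assoc] using hfφβ w hw
    · obtain ⟨φ, hφ, hgφ⟩ := ih (convexOn_affineMap hf.1 g) hz hSz.2 hstrict
      have hφz : φ z ≤ 0 := apply_nonpos_of_mem_hull hφ hSz.2
      have hzero : ∀ w ∈ C, (g + φ) w = 0 := fun w =>
        eq_zero_of_forall_nonneg_of_mem_intrinsicCore hz hgφ (add_nonpos hSz.1 hφz)
      have hgz : g z = 0 := le_antisymm hSz.1 (by linarith [hgφ z hz.1])
      have hzg := mem_intrinsicCore_inter_preimage_singleton hz g
      rw [hgz] at hzg
      obtain ⟨ν, hν, hfν⟩ := ih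
        (hf.subset Set.inter_subset_left (hf.1.inter ((convex_singleton 0).affine_preimage g)))
        hzg hSz.2 (fun w hw => hnonneg w hw.1 hw.2.le)
      obtain ⟨β, hβ⟩ := exists_forall_nonneg_add_mul_of_eq_zero
        (hf.add (convexOn_affineMap hf.1 ν)) hz hgz fun w hw hgw => hfν w ⟨hw, hgw⟩
      exact exists_mem_hull_insert_forall_nonneg_add hφ hν hzero hβ

theorem exists_forall_nonneg_add_sum_mul {κ : Type*} [Fintype κ] {S : Set (V →ᵃ[ℝ] ℝ)}
    (hS : S.Finite) (h : κ → V →ᵃ[ℝ] ℝ) (hf : ConvexOn ℝ C f) (hz : z ∈ intrinsicCore C)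
    (hSz : ∀ g ∈ S, g z ≤ 0) (hhz : ∀ k, h k z = 0)
    (hnonneg : ∀ w ∈ C, (∀ g ∈ S, g w ≤ 0) → (∀ k, h k w = 0) → 0 ≤ f w) :
    ∃ ν : κ → ℝ, ∀ w ∈ C, (∀ g ∈ S, g w ≤ 0) → 0 ≤ f w + ∑ k, ν k * h k w := by
  have hfinite := hS.union ((Set.finite_range h).union (Set.finite_range fun k => -h k))
  obtain ⟨φ, hφ, hfφ⟩ := exists_mem_hull_forall_nonneg_add hfinite hf hz
    (by
      rintro g (hg | ⟨k, rfl⟩ | ⟨k, rfl⟩)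
      exacts [hSz g hg, (hhz k).le, neg_nonpos.2 (hhz k).ge])
    (fun w hw hle => hnonneg w hw (fun g hg => hle g (.inl hg)) fun k => le_antisymm
      (hle _ (.inr (.inl ⟨k, rfl⟩))) (neg_nonpos.1 (hle _ (.inr (.inr ⟨k, rfl⟩)))))
  rw [PointedCone.hull, Submodule.span_union] at hφ
  obtain ⟨α, hα, η, hη, rfl⟩ := Submodule.mem_sup.1 hφ
  have hspan : Set.range h ∪ (Set.range fun k => -h k) ⊆ Submodule.span ℝ (Set.range h) := by
    rintro _ (⟨k, rfl⟩ | ⟨k, rfl⟩)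
    exacts [Submodule.subset_span ⟨k, rfl⟩, neg_mem (Submodule.subset_span ⟨k, rfl⟩)]
  obtain ⟨ν, rfl⟩ := Submodule.mem_span_range_iff_exists_fun ℝ |>.1
    (Submodule.span_le.2 hspan (PointedCone.hull_le_span _ _ hη))
  refine ⟨ν, fun w hw hle => ?_⟩
  have hαw : α w ≤ 0 := apply_nonpos_of_mem_hull hα hle
  let evalAt : (V →ᵃ[ℝ] ℝ) →+ ℝ := ⟨⟨fun g => g w, rfl⟩, fun _ _ => rfl⟩
  have hsum : (∑ k, ν k • h k) w = ∑ k, ν k * h k w := map_sum evalAt _ _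
  have := hfφ w hw
  rw [AffineMap.coe_add, Pi.add_apply, hsum] at this
  linarith

end Multipliers

section Graph

variable {V : Type*} {G : SimpleGraph V}

lemma forall_of_connected (hG : G.Connected) {p : V → Prop} {v : V} (hv : p v)
    (hadj : ∀ i j, G.Adj i j → p i → p j) (j : V) : p j := by
  obtain ⟨walk⟩ := hG.preconnected v j
  induction walk with
  | nil => exact hv
  | cons h _ ih => exact ih (hadj _ _ h hv)

lemma sum_darts_snd_eq [Fintype V] [DecidableEq V] [DecidableRel G.Adj] {M : Type*}
    [AddCommMonoid M] (i : V) (F : V → M) :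
    ∑ e : G.Dart with e.snd = i, F e.fst = ∑ j with G.Adj j i, F j := by
  refine Finset.sum_bij' (fun e _ => e.fst)
    (fun j hj => ⟨(j, i), (Finset.mem_filter.1 hj).2⟩) ?_ ?_ ?_ ?_ ?_
  · intro e he
    have hadj := e.adj
    rw [(Finset.mem_filter.1 he).2] at hadj
    simpa using hadj
  · exact fun j _ => by simp
  · exact fun e he => SimpleGraph.Dart.ext _ _ (Prod.ext rfl (Finset.mem_filter.1 he).2.symm)
  · exact fun _ _ => rfl
  · exact fun _ _ => rfl

end Graph

lemma exists_transpose_mulVec_eq {K m n : Type*} [Field K] [Fintype m] [Fintype n]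
    (A : Matrix m n K) {v : n → K} (hv : ∀ w, A *ᵥ w = 0 → v ⬝ᵥ w = 0) :
    ∃ y, Aᵀ *ᵥ y = v := by
  classical
  let φ : Module.Dual K (n → K) := dotProductEquiv K n v
  have hφ : φ ∈ (LinearMap.ker A.mulVecLin).dualAnnihilator :=
    (Submodule.mem_dualAnnihilator φ).2 hv
  rw [← LinearMap.range_dualMap_eq_dualAnnihilator_ker] at hφ
  obtain ⟨θ, hθ⟩ := hφ
  refine ⟨(dotProductEquiv K m).symm θ, dotProduct_eq _ _ fun w => ?_⟩
  rw [Matrix.mulVec_transpose, ← Matrix.dotProduct_mulVec]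
  exact (LinearMap.congr_fun ((dotProductEquiv K m).apply_symm_apply θ) (A *ᵥ w)).trans
    (LinearMap.congr_fun hθ w)

namespace IsWeightMatrix

variable {N : ℕ} {G : SimpleGraph (Fin N)} {W : Matrix (Fin N) (Fin N) ℝ}

lemma sum_row (hW : IsWeightMatrix G W) (i : Fin N) : ∑ j, W i j = 0 := by
  rw [← Finset.add_sum_erase _ _ (Finset.mem_univ i), hW.diag i, neg_add_cancel]

lemma eq_of_adj_of_forall_le (hW : IsWeightMatrix G W) {w : Fin N → ℝ} {a b : Fin N}
    (ha : (W *ᵥ w) a = 0) (hmax : ∀ k, w k ≤ w a) (hab : G.Adj a b) : w b = w a := by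
  have hsum : ∑ k, W a k * (w k - w a) = 0 := by
    have hrow : ∑ k, W a k * w k = 0 := ha
    simp only [mul_sub, Finset.sum_sub_distrib, ← Finset.sum_mul, hW.sum_row, hrow, zero_mul,
      sub_zero]
  have hnonneg : ∀ k ∈ Finset.univ, 0 ≤ W a k * (w k - w a) := by
    intro k _
    rcases eq_or_ne a k with rfl | hak
    · simp
    by_cases hadj : G.Adj a k
    · exact mul_nonneg_of_nonpos_of_nonpos (hW.neg a k hadj).le (sub_nonpos.2 (hmax k))
    · simp [hW.zero a k hak hadj]
  have hb := (Finset.sum_eq_zero_iff_of_nonneg hnonneg).1 hsum b (Finset.mem_univ b)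
  exact sub_eq_zero.1 ((mul_eq_zero.1 hb).resolve_left (hW.neg a b hab).ne)

lemma exists_eq_const_of_mulVec_eq_zero (hW : IsWeightMatrix G W) (hG : G.Connected)
    {w : Fin N → ℝ} (hw : W *ᵥ w = 0) : ∃ a, ∀ i, w i = a := by
  have := hG.nonempty
  obtain ⟨m, hm⟩ := Finite.exists_max w
  refine ⟨w m, forall_of_connected hG (p := fun i => w i = w m) rfl fun i j hij hi => ?_⟩
  exact (hW.eq_of_adj_of_forall_le (congrFun hw i) (fun k => hi ▸ hm k) hij).trans hi

lemma exists_transpose_mulVec_eq_of_sum_eq_zero (hW : IsWeightMatrix G W) (hG : G.Connected)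
    {v : Fin N → ℝ} (hv : ∑ i, v i = 0) : ∃ y, Wᵀ *ᵥ y = v := by
  refine exists_transpose_mulVec_eq W fun w hw => ?_
  obtain ⟨a, ha⟩ := hW.exists_eq_const_of_mulVec_eq_zero hG hw
  simp only [dotProduct, ha, ← Finset.sum_mul, hv, zero_mul]

lemma diag_smul_add_sum_darts [DecidableRel G.Adj] (hW : IsWeightMatrix G W) {M : Type*}
    [AddCommGroup M] [Module ℝ M] (y : Fin N → M) (i : Fin N) :
    W i i • y i + ∑ e : G.Dart with e.snd = i, W e.fst i • y e.fst = ∑ j, W j i • y j := by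
  rw [sum_darts_snd_eq i (fun j => W j i • y j), ← Finset.add_sum_erase _ _ (Finset.mem_univ i)]
  congr 1
  refine Finset.sum_subset (fun j hj => ?_) fun j hj hadj => ?_
  · have hji : G.Adj j i := by simpa using hj
    simpa using hji.ne
  · rw [hW.zero j i (Finset.ne_of_mem_erase hj) (by simpa using hadj), zero_smul]

lemma exists_diag_smul_add_sum_darts_eq [DecidableRel G.Adj] (hW : IsWeightMatrix G W)
    (hG : G.Connected) {κ : Type*} {v : Fin N → κ → ℝ} (hv : ∑ i, v i = 0) :
    ∃ y : Fin N → κ → ℝ, ∀ i,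
      W i i • y i + ∑ e : G.Dart with e.snd = i, W e.fst i • y e.fst = v i := by
  choose y hy using fun k : κ => hW.exists_transpose_mulVec_eq_of_sum_eq_zero hG
    (v := fun i => v i k) (by simpa using congrFun hv k)
  refine ⟨fun i k => y k i, fun i => funext fun k => ?_⟩
  rw [hW.diag_smul_add_sum_darts (fun i k => y k i)]
  simpa [Matrix.mulVec, dotProduct] using congrFun (hy k) i

end IsWeightMatrix

lemma sum_incidence_smul {N : ℕ} (G : SimpleGraph (Fin N)) {M : Type*} [AddCommGroup M]
    [Module ℝ M] (e : G.Dart) (F : Fin N → M) :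
    ∑ i, incidence G i e • F i = F e.snd - F e.fst := by
  simp [incidence, sub_smul, Finset.sum_sub_distrib]

section ExtendedReal

variable {V : Type*} {S : Set V} {f : V → WithTop ℝ} {p : V}

lemma coe_untopA_of_lt_top {a : WithTop ℝ} (ha : a < ⊤) : (a.untopA : WithTop ℝ) = a := by
  rw [WithTop.untopA_eq_untop ha.ne, WithTop.coe_untop]

lemma convexOn_untopA [AddCommGroup V] [Module ℝ V] (hf : Convex ℝ (epigraphOn S f)) :
    ConvexOn ℝ (effDomOn S f) fun p => (f p).untopA := by
  have hepigraph : {q : V × ℝ | q.1 ∈ effDomOn S f ∧ (f q.1).untopA ≤ q.2} = epigraphOn S f := by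
    ext q
    refine ⟨fun ⟨hq, hle⟩ => ⟨hq.1, ?_⟩, fun ⟨hq, hle⟩ => ?_⟩
    · rwa [← coe_untopA_of_lt_top hq.2, WithTop.coe_le_coe]
    · have htop : f q.1 < ⊤ := hle.trans_lt (WithTop.coe_lt_top _)
      rw [← coe_untopA_of_lt_top htop, WithTop.coe_le_coe] at hle
      exact ⟨⟨hq, htop⟩, hle⟩
  rw [convexOn_iff_convex_epigraph, hepigraph]
  exact hf

lemma convIndicator_of_mem (hp : p ∈ S) : convIndicator S p = 0 := if_pos hp

lemma convIndicator_lt_top_iff : convIndicator S p < ⊤ ↔ p ∈ S := by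
  unfold convIndicator
  split_ifs with h <;> simp [h]

end ExtendedReal

namespace AggProblem

variable {N l : ℕ} (P : AggProblem N l) {G : SimpleGraph (Fin N)}

section Constraints

/-- The pairs `(x_i, σ_i)`, the arguments of the objectives `J_i` in the network Lagrangian. -/
def agentVars : P.Stack G →ₗ[ℝ] ∀ i, (Fin (P.n i) → ℝ) × (Fin l → ℝ) where
  toFun ψ i := (ψ.x i, ψ.sig i)
  map_add' _ _ := rfl
  map_smul' _ _ := rfl

/-- `A_i x_i + σ_i`, the total load `∑_j A_j x_j` as estimated by agent `i`. -/
def load : P.Stack G →ₗ[ℝ] Fin N → Fin l → ℝ where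
  toFun ψ i := P.A i *ᵥ ψ.x i + ψ.sig i
  map_add' ψ φ := by
    ext1 i
    simp only [Stack.x, Stack.sig, Prod.fst_add, Prod.snd_add, Pi.add_apply, Matrix.mulVec_add]
    abel
  map_smul' a ψ := by
    ext1 i
    simp only [Stack.x, Stack.sig, Prod.smul_fst, Prod.smul_snd, Pi.smul_apply,
      Matrix.mulVec_smul, smul_add, RingHom.id_apply]

/-- The disagreement `A_i x_i + σ_i - A_j x_j - σ_j` along a directed edge `(j, i)`, whose
multiplier is `λ_ji`. -/
def loadGap : P.Stack G →ₗ[ℝ] G.Dart → Fin l → ℝ where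
  toFun ψ e := P.load ψ e.snd - P.load ψ e.fst
  map_add' ψ φ := by
    ext1 e
    simp only [map_add, Pi.add_apply]
    abel
  map_smul' a ψ := by
    ext1 e
    simp only [map_smul, Pi.smul_apply, smul_sub, RingHom.id_apply]

/-- The error `y_ji - y_j` of the estimate held along a directed edge `(j, i)`, whose multiplier
is `μ_ji`. -/
def estError : P.Stack G →ₗ[ℝ] G.Dart → Fin l → ℝ where
  toFun ψ e := ψ.est e - ψ.y e.fst
  map_add' ψ φ := by
    ext1 e
    simp only [Stack.est, Stack.y, Prod.fst_add, Prod.snd_add, Pi.add_apply]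
    abel
  map_smul' a ψ := by
    ext1 e
    simp only [Stack.est, Stack.y, Prod.smul_fst, Prod.smul_snd, Pi.smul_apply, smul_sub,
      RingHom.id_apply]

/-- A state is consistent when the two families of dualized constraints hold: all agents agree on
the load, and all estimates are exact. -/
def IsConsistent (ψ : P.Stack G) : Prop := P.loadGap ψ = 0 ∧ P.estError ψ = 0

/-- The multiplier terms `K` of the network Lagrangian, with the multipliers separated from the
state: the paper's `K(ψ)` is `P.coupling ψ.lam ψ.mu ψ`. -/
def coupling [DecidableRel G.Adj] (lam mu : G.Dart → Fin l → ℝ) (ψ : P.Stack G) : ℝ :=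
  ∑ e, lam e ⬝ᵥ P.loadGap ψ e + ∑ e, mu e ⬝ᵥ P.estError ψ e

variable [DecidableRel G.Adj]

lemma coupling_sub (lam mu : G.Dart → Fin l → ℝ) (ψ φ : P.Stack G) :
    P.coupling lam mu (ψ - φ) = P.coupling lam mu ψ - P.coupling lam mu φ := by
  simp only [coupling, map_sub, Pi.sub_apply, dotProduct_sub, Finset.sum_sub_distrib]
  ring

lemma coupling_sub_left (lam lam' mu mu' : G.Dart → Fin l → ℝ) (ψ : P.Stack G) :
    P.coupling (lam - lam') (mu - mu') ψ = P.coupling lam mu ψ - P.coupling lam' mu' ψ := by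
  simp only [coupling, Pi.sub_apply, sub_dotProduct, Finset.sum_sub_distrib]
  ring

variable {P} in
lemma IsConsistent.coupling_eq_zero {ψ : P.Stack G} (hψ : P.IsConsistent ψ)
    (lam mu : G.Dart → Fin l → ℝ) : P.coupling lam mu ψ = 0 := by
  simp [coupling, hψ.1, hψ.2]

lemma isConsistent_of_coupling_self_nonpos {ψ : P.Stack G}
    (h : P.coupling (P.loadGap ψ) (P.estError ψ) ψ ≤ 0) : P.IsConsistent ψ := by
  have hsq : ∀ v : Fin l → ℝ, 0 ≤ v ⬝ᵥ v := fun v =>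
    Finset.sum_nonneg fun k _ => mul_self_nonneg (v k)
  have hgap : ∀ e ∈ Finset.univ, 0 ≤ P.loadGap ψ e ⬝ᵥ P.loadGap ψ e := fun _ _ => hsq _
  have herr : ∀ e ∈ Finset.univ, 0 ≤ P.estError ψ e ⬝ᵥ P.estError ψ e := fun _ _ => hsq _
  have hgap_sum := Finset.sum_nonneg hgap
  have herr_sum := Finset.sum_nonneg herr
  unfold coupling at h
  have hgap_zero := (Finset.sum_eq_zero_iff_of_nonneg hgap).1 (by linarith)
  have herr_zero := (Finset.sum_eq_zero_iff_of_nonneg herr).1 (by linarith)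
  exact ⟨funext fun e => dotProduct_self_eq_zero.1 (hgap_zero e (Finset.mem_univ e)),
    funext fun e => dotProduct_self_eq_zero.1 (herr_zero e (Finset.mem_univ e))⟩

end Constraints

section SkewPart

variable [DecidableRel G.Adj]

lemma sum_dotProduct_incidence (a : Fin N → Fin l → ℝ) (lam : G.Dart → Fin l → ℝ) :
    ∑ i, (∑ e, incidence G i e • lam e) ⬝ᵥ a i = ∑ e, lam e ⬝ᵥ (a e.snd - a e.fst) := by
  simp_rw [← sum_incidence_smul G, sum_dotProduct, dotProduct_sum, smul_dotProduct,
    dotProduct_smul]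
  exact Finset.sum_comm

lemma sum_dotProduct_fiberwise_fst (b : Fin N → Fin l → ℝ) (mu : G.Dart → Fin l → ℝ) :
    ∑ i, (∑ e : G.Dart with e.fst = i, mu e) ⬝ᵥ b i = ∑ e, mu e ⬝ᵥ b e.fst := by
  simp_rw [sum_dotProduct]
  rw [← Finset.sum_fiberwise Finset.univ fun e : G.Dart => e.fst]
  refine Finset.sum_congr rfl fun i _ => Finset.sum_congr rfl fun e he => ?_
  rw [(Finset.mem_filter.1 he).2]

lemma skewPart_lam (ψ : P.Stack G) : Stack.lam (P.skewPart G ψ) = -P.loadGap ψ := by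
  ext1 e
  change -∑ i, incidence G i e • (P.A i *ᵥ ψ.x i) - ∑ i, incidence G i e • ψ.sig i
    = -(P.A e.snd *ᵥ ψ.x e.snd + ψ.sig e.snd - (P.A e.fst *ᵥ ψ.x e.fst + ψ.sig e.fst))
  rw [sum_incidence_smul G e fun i => P.A i *ᵥ ψ.x i, sum_incidence_smul G e ψ.sig]
  abel

lemma skewPart_mu (ψ : P.Stack G) : Stack.mu (P.skewPart G ψ) = -P.estError ψ :=
  funext fun e => (neg_sub (ψ.est e) (ψ.y e.fst)).symm

lemma stackInner_skewPart (ψ φ : P.Stack G) :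
    P.stackInner G (P.skewPart G ψ) φ
      = P.coupling ψ.lam ψ.mu φ - P.coupling φ.lam φ.mu ψ := by
  have hx : ∑ i, Stack.x (P.skewPart G ψ) i ⬝ᵥ φ.x i
      = ∑ e, ψ.lam e ⬝ᵥ (P.A e.snd *ᵥ φ.x e.snd - P.A e.fst *ᵥ φ.x e.fst) := by
    rw [← sum_dotProduct_incidence fun i => P.A i *ᵥ φ.x i]
    refine Finset.sum_congr rfl fun i _ => ?_
    rw [Matrix.dotProduct_mulVec, ← Matrix.mulVec_transpose]
    rfl
  have hsig : ∑ i, Stack.sig (P.skewPart G ψ) i ⬝ᵥ φ.sig i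
      = ∑ e, ψ.lam e ⬝ᵥ (φ.sig e.snd - φ.sig e.fst) := sum_dotProduct_incidence φ.sig ψ.lam
  have hy : ∑ i, Stack.y (P.skewPart G ψ) i ⬝ᵥ φ.y i = -∑ e, ψ.mu e ⬝ᵥ φ.y e.fst := by
    rw [← sum_dotProduct_fiberwise_fst φ.y, ← Finset.sum_neg_distrib]
    exact Finset.sum_congr rfl fun i _ => neg_dotProduct _ _
  have hest : ∑ e, Stack.est (P.skewPart G ψ) e ⬝ᵥ φ.est e = ∑ e, ψ.mu e ⬝ᵥ φ.est e := rfl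
  have hgap : ∀ e, P.loadGap φ e = (P.A e.snd *ᵥ φ.x e.snd - P.A e.fst *ᵥ φ.x e.fst)
      + (φ.sig e.snd - φ.sig e.fst) := fun e => add_sub_add_comm _ _ _ _
  have herr : ∀ e, P.estError φ e = φ.est e - φ.y e.fst := fun _ => rfl
  rw [stackInner, hx, hsig, hy, hest, skewPart_lam, skewPart_mu]
  simp only [coupling, hgap, herr, Pi.neg_apply, neg_dotProduct, dotProduct_add,
    dotProduct_sub, Finset.sum_sub_distrib, Finset.sum_add_distrib, Finset.sum_neg_distrib,
    dotProduct_comm (φ.lam _), dotProduct_comm (φ.mu _)]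
  ring

lemma stackInner_neg (u v : P.Stack G) : P.stackInner G (-u) v = -P.stackInner G u v := by
  simp only [stackInner, Stack.x, Stack.sig, Stack.lam, Stack.y, Stack.mu, Stack.est,
    Prod.fst_neg, Prod.snd_neg, Pi.neg_apply, neg_dotProduct, Finset.sum_neg_distrib]
  ring

end SkewPart

section PrimalPart

variable [DecidableRel G.Adj] (W : Matrix (Fin N) (Fin N) ℝ)

/-- The defect of the equations defining the sets `F_i`, which encode through `W` that the `σ_i`
are the aggregates. -/
def aggResidual : P.Stack G →ₗ[ℝ] Fin N → Fin l → ℝ where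
  toFun ψ i := ((N : ℝ) - 1) • (P.A i *ᵥ ψ.x i) - ψ.sig i
    - (W i i • ψ.y i + ∑ e : G.Dart with e.snd = i, W e.fst i • ψ.est e)
  map_add' ψ φ := by
    ext1 i
    simp only [Stack.x, Stack.sig, Stack.y, Stack.est, Prod.fst_add, Prod.snd_add, Pi.add_apply,
      Matrix.mulVec_add, smul_add, Finset.sum_add_distrib]
    abel
  map_smul' a ψ := by
    ext1 i
    simp only [Stack.x, Stack.sig, Stack.y, Stack.est, Prod.smul_fst, Prod.smul_snd,
      Pi.smul_apply, Matrix.mulVec_smul, smul_comm _ a, ← Finset.smul_sum, RingHom.id_apply,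
      smul_sub, smul_add]

/-- The real-valued network cost `∑_i J_i(x_i, σ_i)`. A term with `J_i = +∞` has a junk value, so
this is meaningful only on `netDomain`. -/
def cost (ψ : P.Stack G) : ℝ := ∑ i, (P.J i (P.agentVars ψ i)).untopA

/-- The states with finite cost, `x_i ∈ X_i` and all equations `F_i`, but without the inequality
constraints `Q_i`. -/
def netDomain : Set (P.Stack G) :=
  P.agentVars ⁻¹' Set.univ.pi (fun i => effDomOn (P.objDomain i) (P.J i))
    ∩ P.aggResidual W ⁻¹' {0}

/-- The effective domain of the primal part `Θ` of the network Lagrangian. -/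
def netFeasible : Set (P.Stack G) :=
  {ψ ∈ P.netDomain W | ∀ i, P.load ψ i ≤ P.c}

variable {P W} {ψ : P.Stack G}

lemma mem_netDomain_iff : ψ ∈ P.netDomain W ↔ ∀ i,
    (ψ.x i, ψ.sig i) ∈ effDomOn (P.objDomain i) (P.J i) ∧ ψ ∈ P.setF G W i := by
  have hF : P.aggResidual W ψ = 0 ↔ ∀ i, ψ ∈ P.setF G W i :=
    funext_iff.trans (forall_congr' fun i => sub_eq_zero)
  rw [forall_and, ← hF]
  exact and_congr_left fun _ => Set.mem_univ_pi

lemma primalPart_lt_top_iff : P.primalPart G W ψ < ⊤ ↔ ψ ∈ P.netFeasible W := by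
  simp only [primalPart, WithTop.sum_lt_top, Finset.mem_univ, true_implies, WithTop.add_lt_top,
    convIndicator_lt_top_iff]
  change _ ↔ ψ ∈ P.netDomain W ∧ _
  rw [mem_netDomain_iff, ← forall_and]
  refine forall_congr' fun i => ?_
  change ((_ ∧ _) ∧ _) ∧ _ ↔ (((_ ∧ True) ∧ _) ∧ _) ∧ P.A i *ᵥ ψ.x i + ψ.sig i ≤ P.c
  simp only [setQ, Set.mem_ofPred_eq]
  tauto

lemma primalPart_eq_cost (hψ : ψ ∈ P.netFeasible W) : P.primalPart G W ψ = P.cost ψ := by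
  have hdom := mem_netDomain_iff.1 hψ.1
  rw [primalPart, cost, WithTop.coe_sum]
  refine Finset.sum_congr rfl fun i _ => ?_
  have hQ : (ψ.x i, ψ.sig i) ∈ P.setQ i := hψ.2 i
  rw [convIndicator_of_mem (hdom i).1.1.1, convIndicator_of_mem hQ,
    convIndicator_of_mem (hdom i).2, add_zero, add_zero, add_zero]
  exact (coe_untopA_of_lt_top (hdom i).1.2).symm

variable (W) in
lemma convexOn_cost (hJ : ∀ i, Convex ℝ (epigraphOn (P.objDomain i) (P.J i))) :
    ConvexOn ℝ (P.netDomain W) (P.cost (G := G)) := by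
  have hagent := fun i => convexOn_untopA (hJ i)
  have hconvex : Convex ℝ (P.netDomain (G := G) W) :=
    ((convex_pi fun i _ => (hagent i).1).linear_preimage _).inter
      ((convex_singleton 0).linear_preimage _)
  refine ⟨hconvex, fun ψ hψ φ hφ a b ha hb hab => ?_⟩
  simp only [cost, Finset.smul_sum, ← Finset.sum_add_distrib]
  exact Finset.sum_le_sum fun i _ =>
    (hagent i).2 (hψ.1 i trivial) (hφ.1 i trivial) ha hb hab

end PrimalPart

section KKT

variable {P} [DecidableRel G.Adj] {W : Matrix (Fin N) (Fin N) ℝ} {ψ : P.Stack G}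

lemma mem_zerT_iff_neg_skewPart_mem :
    ψ ∈ P.zerT G W ↔ -P.skewPart G ψ ∈ P.subdifferential G (P.primalPart G W) ψ := by
  constructor
  · rintro ⟨u, hu, hzero⟩
    rwa [← eq_neg_of_add_eq_zero_left hzero.symm]
  · exact fun h => ⟨_, h, (neg_add_cancel _).symm⟩

lemma mem_zerT_iff_isSaddle :
    ψ ∈ P.zerT G W ↔ ψ ∈ P.netFeasible W ∧ ∀ φ ∈ P.netFeasible (G := G) W,
      P.cost ψ + P.coupling (Stack.lam φ) (Stack.mu φ) ψ
        ≤ P.cost φ + P.coupling ψ.lam ψ.mu φ := by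
  rw [mem_zerT_iff_neg_skewPart_mem]
  refine (and_congr_left' primalPart_lt_top_iff).trans (and_congr_right fun hψ => ?_)
  have hgrad : ∀ φ : P.Stack G, P.stackInner G (-P.skewPart G ψ) (φ - ψ)
      = P.coupling φ.lam φ.mu ψ - P.coupling ψ.lam ψ.mu φ := by
    intro φ
    rw [stackInner_neg, stackInner_skewPart, coupling_sub]
    change -(_ - P.coupling (φ.lam - ψ.lam) (φ.mu - ψ.mu) ψ) = _
    rw [coupling_sub_left]
    ring
  simp only [primalPart_eq_cost hψ, hgrad, ← WithTop.coe_add]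
  refine forall_congr' fun φ => ⟨fun h hφ => ?_, fun h => ?_⟩
  · rw [primalPart_eq_cost hφ, WithTop.coe_le_coe] at h
    linarith
  · rcases lt_or_eq_of_le (le_top (a := P.primalPart G W φ)) with htop | htop
    · have hφ := primalPart_lt_top_iff.1 htop
      rw [primalPart_eq_cost hφ, WithTop.coe_le_coe]
      linarith [h hφ]
    · rw [htop]
      exact le_top

lemma isConsistent_of_mem_zerT (hψ : ψ ∈ P.zerT G W) : P.IsConsistent ψ := by
  obtain ⟨hfeasible, hsaddle⟩ := mem_zerT_iff_isSaddle.1 hψ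
  -- Moving the multipliers along the violated constraints cannot raise the Lagrangian.
  have h := hsaddle (ψ.x, ψ.sig, ψ.lam + P.loadGap ψ, ψ.y, ψ.mu + P.estError ψ, ψ.est) hfeasible
  change P.cost ψ + P.coupling (ψ.lam + P.loadGap ψ) (ψ.mu + P.estError ψ) ψ
    ≤ P.cost ψ + P.coupling ψ.lam ψ.mu ψ at h
  have hsub := P.coupling_sub_left (ψ.lam + P.loadGap ψ) ψ.lam (ψ.mu + P.estError ψ) ψ.mu ψ
  rw [add_sub_cancel_left, add_sub_cancel_left] at hsub
  exact P.isConsistent_of_coupling_self_nonpos (by linarith)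

lemma mem_zerT_iff_isConsistent :
    ψ ∈ P.zerT G W ↔ ψ ∈ P.netFeasible W ∧ P.IsConsistent ψ ∧
      ∀ φ ∈ P.netFeasible (G := G) W, P.cost ψ ≤ P.cost φ + P.coupling ψ.lam ψ.mu φ := by
  constructor
  · intro hψ
    have hcons := isConsistent_of_mem_zerT hψ
    obtain ⟨hfeasible, hsaddle⟩ := mem_zerT_iff_isSaddle.1 hψ
    exact ⟨hfeasible, hcons, fun φ hφ => by
      simpa only [hcons.coupling_eq_zero, add_zero] using hsaddle φ hφ⟩
  · rintro ⟨hfeasible, hcons, hmin⟩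
    exact mem_zerT_iff_isSaddle.2 ⟨hfeasible, fun φ hφ => by
      simpa only [hcons.coupling_eq_zero, add_zero] using hmin φ hφ⟩

end KKT

section Consistent

lemma mulVec_add_aggregate (x : P.Decision) (i : Fin N) :
    P.A i *ᵥ x i + P.aggregate i x = ∑ j, P.A j *ᵥ x j :=
  Finset.add_sum_erase _ (fun j => P.A j *ᵥ x j) (Finset.mem_univ i)

lemma sum_smul_mulVec_sub (x : P.Decision) (σ : Fin N → Fin l → ℝ) :
    ∑ i, (((N : ℝ) - 1) • (P.A i *ᵥ x i) - σ i)
      = ∑ i, (∑ j, P.A j *ᵥ x j - (P.A i *ᵥ x i + σ i)) := by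
  simp only [sub_smul, one_smul, Finset.sum_sub_distrib, Finset.sum_add_distrib,
    ← Finset.smul_sum, Finset.sum_const, Finset.card_univ, Fintype.card_fin, Nat.cast_smul_eq_nsmul]
  abel

/-- The state with decisions `x` in which all `σ_i` are exact aggregates and all estimates of `y`
are exact. -/
def consistentState (x : P.Decision) (y : Fin N → Fin l → ℝ) (lam mu : G.Dart → Fin l → ℝ) :
    P.Stack G :=
  (x, fun i => P.aggregate i x, lam, y, mu, fun e => y e.fst)

lemma load_consistentState (x : P.Decision) (y : Fin N → Fin l → ℝ)
    (lam mu : G.Dart → Fin l → ℝ) (i : Fin N) :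
    P.load (P.consistentState x y lam mu) i = ∑ j, P.A j *ᵥ x j :=
  P.mulVec_add_aggregate x i

lemma isConsistent_consistentState (x : P.Decision) (y : Fin N → Fin l → ℝ)
    (lam mu : G.Dart → Fin l → ℝ) : P.IsConsistent (P.consistentState x y lam mu) := by
  refine ⟨funext fun e => sub_eq_zero.2 ?_, funext fun e => sub_self (y e.fst)⟩
  rw [load_consistentState, load_consistentState]

variable {P} in
lemma IsConsistent.load_eq {ψ : P.Stack G} (hψ : P.IsConsistent ψ) (hG : G.Connected)
    (i j : Fin N) : P.load ψ i = P.load ψ j :=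
  forall_of_connected hG (p := fun k => P.load ψ k = P.load ψ j) rfl
    (fun a b hab ha => (sub_eq_zero.1 (congrFun hψ.1 ⟨(a, b), hab⟩)).trans ha) i

variable [DecidableRel G.Adj] {W : Matrix (Fin N) (Fin N) ℝ}

lemma exists_forall_aggResidual_consistentState_eq_zero (hG : G.Connected)
    (hW : IsWeightMatrix G W) (x : P.Decision) :
    ∃ y, ∀ lam mu : G.Dart → Fin l → ℝ,
      P.aggResidual W (P.consistentState x y lam mu) = 0 := by
  have hsum : ∑ i, (((N : ℝ) - 1) • (P.A i *ᵥ x i) - P.aggregate i x) = 0 := by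
    simp only [sum_smul_mulVec_sub, mulVec_add_aggregate, sub_self, Finset.sum_const_zero]
  obtain ⟨y, hy⟩ := hW.exists_diag_smul_add_sum_darts_eq hG hsum
  exact ⟨y, fun lam mu => funext fun i => sub_eq_zero.2 (hy i).symm⟩

variable {P} {ψ : P.Stack G}

lemma IsConsistent.sum_smul_mulVec_sub_eq_zero (hψ : P.IsConsistent ψ) (hW : IsWeightMatrix G W)
    (hres : P.aggResidual W ψ = 0) :
    ∑ i, (((N : ℝ) - 1) • (P.A i *ᵥ ψ.x i) - ψ.sig i) = 0 := by
  have hest : ∀ e, ψ.est e = ψ.y e.fst := fun e => sub_eq_zero.1 (congrFun hψ.2 e)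
  have hF : ∀ i, ((N : ℝ) - 1) • (P.A i *ᵥ ψ.x i) - ψ.sig i = ∑ j, W j i • ψ.y j := by
    intro i
    rw [← hW.diag_smul_add_sum_darts, sub_eq_zero.1 (congrFun hres i)]
    simp only [hest]
  simp_rw [hF]
  rw [Finset.sum_comm]
  simp only [← Finset.sum_smul, hW.sum_row, zero_smul, Finset.sum_const_zero]

lemma IsConsistent.sig_eq_aggregate (hψ : P.IsConsistent ψ) (hG : G.Connected)
    (hW : IsWeightMatrix G W) (hres : P.aggResidual W ψ = 0) (i : Fin N) :
    ψ.sig i = P.aggregate i ψ.x := by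
  have hsum := hψ.sum_smul_mulVec_sub_eq_zero hW hres
  have hload : ∀ j, P.A j *ᵥ ψ.x j + ψ.sig j = P.A i *ᵥ ψ.x i + ψ.sig i := fun j =>
    hψ.load_eq hG j i
  simp only [sum_smul_mulVec_sub, hload, Finset.sum_const, Finset.card_univ,
    Fintype.card_fin] at hsum
  have htotal := sub_eq_zero.1 ((smul_eq_zero.1 hsum).resolve_left (Fin.pos i).ne')
  rw [← P.mulVec_add_aggregate ψ.x i] at htotal
  exact (add_left_cancel htotal).symm

lemma IsConsistent.x_mem_feasible (hψ : P.IsConsistent ψ) (hG : G.Connected)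
    (hW : IsWeightMatrix G W) (hfeasible : ψ ∈ P.netFeasible W) : ψ.x ∈ P.feasible := by
  refine ⟨fun i => (hfeasible.1.1 i trivial).1.1, ?_⟩
  obtain ⟨i⟩ := hG.nonempty
  rw [← P.mulVec_add_aggregate ψ.x i, ← hψ.sig_eq_aggregate hG hW hfeasible.1.2 i]
  exact hfeasible.2 i

lemma IsConsistent.objective_x (hψ : P.IsConsistent ψ) (hG : G.Connected)
    (hW : IsWeightMatrix G W) (hdom : ψ ∈ P.netDomain W) : P.objective ψ.x = P.cost ψ := by
  rw [objective, cost, WithTop.coe_sum]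
  refine Finset.sum_congr rfl fun i _ => ?_
  rw [← hψ.sig_eq_aggregate hG hW hdom.2 i]
  exact (coe_untopA_of_lt_top (hdom.1 i trivial).2).symm

lemma exists_forall_consistentState_mem_netFeasible (hG : G.Connected) (hW : IsWeightMatrix G W)
    {x : P.Decision} (hx : x ∈ P.feasible) (htop : P.objective x < ⊤) :
    ∃ y, ∀ lam mu : G.Dart → Fin l → ℝ, P.consistentState x y lam mu ∈ P.netFeasible W := by
  obtain ⟨y, hy⟩ := P.exists_forall_aggResidual_consistentState_eq_zero hG hW x
  refine ⟨y, fun lam mu => ⟨⟨fun i _ => ⟨⟨hx.1 i, trivial⟩, ?_⟩, hy lam mu⟩, fun i => ?_⟩⟩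
  · exact WithTop.sum_lt_top.1 htop i (Finset.mem_univ i)
  · rw [load_consistentState]
    exact hx.2

end Consistent

section Optimality

variable {P} [DecidableRel G.Adj] {W : Matrix (Fin N) (Fin N) ℝ}

theorem isMinimizer_of_mem_zerT (hG : G.Connected) (hW : IsWeightMatrix G W) {ψ : P.Stack G}
    (hψ : ψ ∈ P.zerT G W) : P.IsMinimizer ψ.x := by
  obtain ⟨hfeasible, hcons, hmin⟩ := mem_zerT_iff_isConsistent.1 hψ
  have hobj := hcons.objective_x hG hW hfeasible.1
  refine ⟨hcons.x_mem_feasible hG hW hfeasible, hobj ▸ WithTop.coe_lt_top _, fun x' hx' => ?_⟩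
  rcases lt_or_eq_of_le (le_top (a := P.objective x')) with htop | htop
  · obtain ⟨y, hy⟩ := exists_forall_consistentState_mem_netFeasible hG hW hx' htop
    let φ := P.consistentState x' y ψ.lam ψ.mu
    have hφ : P.IsConsistent φ := P.isConsistent_consistentState x' y ψ.lam ψ.mu
    have hobj' : P.objective x' = P.cost φ := hφ.objective_x hG hW (hy _ _).1
    rw [hobj, hobj', WithTop.coe_le_coe]
    simpa only [hφ.coupling_eq_zero, add_zero] using hmin φ (hy _ _)
  · rw [htop]
    exact le_top

/-- The `(a, b)` entry of an array-valued linear map, as an affine function. -/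
def entryAffine {V α β : Type*} [AddCommGroup V] [Module ℝ V] (L : V →ₗ[ℝ] α → β → ℝ)
    (k : α × β) : V →ᵃ[ℝ] ℝ :=
  (LinearMap.proj k.2 ∘ₗ LinearMap.proj k.1 ∘ₗ L).toAffineMap

lemma mem_intrinsicCore_netDomain {ψ : P.Stack G} (hres : P.aggResidual W ψ = 0)
    (hinterior : ∀ i, P.agentVars ψ i ∈
      intrinsicInterior ℝ (effDomOn (P.objDomain i) (P.J i))) :
    ψ ∈ intrinsicCore (P.netDomain W) := by
  have hpi := pi_intrinsicCore_subset _ fun i _ =>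
    intrinsicInterior_subset_intrinsicCore (hinterior i)
  have hpre := preimage_intrinsicCore_subset P.agentVars.toAffineMap _ hpi
  have hmem := mem_intrinsicCore_inter_preimage_singleton hpre (P.aggResidual W).toAffineMap
  have hzero : (P.aggResidual W).toAffineMap ψ = 0 := hres
  rwa [hzero] at hmem

theorem exists_forall_le_cost_add_coupling {ψ : P.Stack G}
    (hJ : ∀ i, Convex ℝ (epigraphOn (P.objDomain i) (P.J i)))
    (hcore : ψ ∈ intrinsicCore (P.netDomain W)) (hload : ∀ i, P.load ψ i ≤ P.c)
    (hcons : P.IsConsistent ψ) {b : ℝ}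
    (hb : ∀ φ ∈ P.netFeasible (G := G) W, P.IsConsistent φ → b ≤ P.cost φ) :
    ∃ lam mu : G.Dart → Fin l → ℝ, ∀ φ ∈ P.netFeasible (G := G) W,
      b ≤ P.cost φ + P.coupling lam mu φ := by
  let S : Set (P.Stack G →ᵃ[ℝ] ℝ) := Set.range fun k : Fin N × Fin l =>
    entryAffine P.load k - AffineMap.const ℝ _ (P.c k.2)
  have hS : ∀ φ : P.Stack G, (∀ g ∈ S, g φ ≤ 0) ↔ ∀ i, P.load φ i ≤ P.c := fun φ => by
    simp only [S, Set.forall_mem_range, Prod.forall, Pi.le_def]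
    exact forall_congr' fun i => forall_congr' fun k => sub_nonpos
  let h : G.Dart × Fin l ⊕ G.Dart × Fin l → P.Stack G →ᵃ[ℝ] ℝ :=
    Sum.elim (entryAffine P.loadGap) (entryAffine P.estError)
  have hh : ∀ φ : P.Stack G, (∀ k, h k φ = 0) ↔ P.IsConsistent φ := fun φ => by
    simp only [h, Sum.forall, Prod.forall, Sum.elim_inl, Sum.elim_inr, IsConsistent, funext_iff]
    rfl
  obtain ⟨ν, hν⟩ := exists_forall_nonneg_add_sum_mul (S := S) (Set.finite_range _) h
    ((convexOn_cost W hJ).sub (concaveOn_const b (convexOn_cost W hJ).1)) hcore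
    ((hS ψ).2 hload) ((hh ψ).2 hcons)
    (fun φ hφ hQ hE => sub_nonneg.2 (hb φ ⟨hφ, (hS φ).1 hQ⟩ ((hh φ).1 hE)))
  refine ⟨fun e k => ν (.inl (e, k)), fun e k => ν (.inr (e, k)), fun φ hφ => ?_⟩
  have hcoupling : ∑ k, ν k * h k φ = P.coupling (fun e k => ν (.inl (e, k)))
      (fun e k => ν (.inr (e, k))) φ := by
    simp only [Fintype.sum_sum_type, Fintype.sum_prod_type]
    rfl
  have hφν : 0 ≤ P.cost φ - b + ∑ k, ν k * h k φ := hν φ hφ.1 ((hS φ).2 hφ.2)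
  linarith

theorem exists_mem_zerT_of_isMinimizer
    (hJ : ∀ i, Convex ℝ (epigraphOn (P.objDomain i) (P.J i))) (hG : G.Connected)
    (hW : IsWeightMatrix G W) (hdom : P.DomainQualified) {x : P.Decision}
    (hx : P.IsMinimizer x) : ∃ y, ∃ lam mu : G.Dart → Fin l → ℝ,
      P.consistentState x y lam mu ∈ P.zerT G W := by
  obtain ⟨x₀, hx₀, hcore⟩ := hdom
  obtain ⟨y₀, hy₀⟩ := P.exists_forall_aggResidual_consistentState_eq_zero hG hW x₀
  obtain ⟨y, hy⟩ := exists_forall_consistentState_mem_netFeasible hG hW hx.1 hx.2.1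
  have hcons := P.isConsistent_consistentState (G := G) x y
  have hobj : ∀ lam mu, P.objective x = P.cost (P.consistentState x y lam mu) := fun lam mu =>
    (hcons lam mu).objective_x hG hW (hy lam mu).1
  obtain ⟨lam, mu, hmin⟩ := exists_forall_le_cost_add_coupling hJ
    (mem_intrinsicCore_netDomain (hy₀ 0 0) hcore)
    (fun i => (P.load_consistentState x₀ y₀ 0 0 i).trans_le hx₀.2)
    (P.isConsistent_consistentState x₀ y₀ 0 0) (b := P.cost (P.consistentState x y 0 0))
    fun φ hφ hφcons => by
      rw [← WithTop.coe_le_coe, ← hobj, ← hφcons.objective_x hG hW hφ.1]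
      exact hx.2.2 _ (hφcons.x_mem_feasible hG hW hφ)
  exact ⟨y, lam, mu, mem_zerT_iff_isConsistent.2 ⟨hy lam mu, hcons lam mu, hmin⟩⟩

end Optimality

end AggProblem

end

theorem theorem1_general {N l : ℕ} (P : AggProblem N l) (G : SimpleGraph (Fin N))
    [DecidableRel G.Adj] (W : Matrix (Fin N) (Fin N) ℝ) (hG : G.Connected)
    (hW : IsWeightMatrix G W) :
    (∀ ψ ∈ P.zerT G W, P.IsMinimizer ψ.x) ∧
    ((∀ i, Convex ℝ (epigraphOn (P.objDomain i) (P.J i))) → P.DomainQualified →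
      ∀ x : P.Decision, P.IsMinimizer x →
        ∃ (σ : Fin N → Fin l → ℝ) (lam : G.Dart → Fin l → ℝ) (ω : P.Omega G),
          (x, σ, lam, ω) ∈ P.zerT G W) := by
  refine ⟨fun ψ hψ => AggProblem.isMinimizer_of_mem_zerT hG hW hψ, fun hJ hdom x hx => ?_⟩
  obtain ⟨y, lam, mu, hzero⟩ := AggProblem.exists_mem_zerT_of_isMinimizer hJ hG hW hdom hx
  exact ⟨_, _, _, hzero⟩

theorem theorem1 {N l : ℕ} (P : AggProblem N l)
    (G : SimpleGraph (Fin N)) [DecidableRel G.Adj] (W : Matrix (Fin N) (Fin N) ℝ)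
    (hJ : ∀ i, IsCCPOn (P.objDomain i) (P.J i))
    (hX : ∀ i, (P.X i).Nonempty ∧ IsClosed (P.X i) ∧ Convex ℝ (P.X i))
    (hSlater : P.Slater)
    (hG : G.Connected) (hout : ∀ i, ∃ j, G.Adj i j)
    (hW : IsWeightMatrix G W) :
    (∀ ψ ∈ P.zerT G W, P.IsMinimizer ψ.x) ∧
    (P.DomainQualified → ∀ x : P.Decision, P.IsMinimizer x →
      ∃ (σ : Fin N → Fin l → ℝ) (lam : G.Dart → Fin l → ℝ) (ω : P.Omega G),
        (x, σ, lam, ω) ∈ P.zerT G W) := by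
  obtain ⟨hmin, hzero⟩ := theorem1_general P G W hG hW
  exact ⟨hmin, hzero fun i => (hJ i).convex⟩
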